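/- Let $\Gamma$ be a finitely generated group with a finite symmetric generating set $\Sigma$, let $B_r\subseteq\Gamma$ be the ball of radius $r$ around the unit in the Cayley graph of $(\Gamma,\Sigma)$, and let $\mathcal{C}=\{0,1\}^{\mathbb{N}}$ be the Cantor set. A free Cantor action is an action $\alpha:\Gamma\curvearrowright\mathcal{C}$ by homeomorphisms such that $\alpha(\gamma)(x)\neq x$ for all $x\in\mathcal{C}$ and $\gamma\neq e$. For an action $\alpha$ of $\Gamma$ on a space $X$ and a map $\phi:X\to Q$ let $$\mathrm{Conf}_{r,\alpha}(\phi)=\bigl\{\,(\gamma\mapsto\phi(\alpha(\gamma)(x)))\in Q^{B_r} \;:\; x\in X\,\bigr\}.$$ Say that $A\subseteq(\{0,1\}^k)^{B_n}$ is a configuration set of $\alpha$ if $A=\mathrm{Conf}_{n,\alpha}(\phi)$ for some continuous $\phi:X\to\{0,1\}^k$. A free Cantor action $\alpha$ qualitatively weakly contains a free Cantor action $\beta$ if for every finite (discrete) set $Q$, every continuous $\psi:\mathcal{C}\to Q$ and every integer $r>0$ there is a continuous $\phi:\mathcal{C}\to Q$ with $\mathrm{Conf}_{r,\alpha}(\phi)=\mathrm{Conf}_{r,\beta}(\psi)$;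 the two actions are qualitatively weakly equivalent if each weakly contains the other. Let $\mathrm{Free}(\Gamma)$ be the set of qualitative weak equivalence classes of free Cantor actions of $\Gamma$, with the metric $d_w$ given by $d_w([\alpha],[\beta])=2^{-n}$, where $n\geq 1$ is the smallest integer for which $\alpha$ and $\beta$ do not have the same configuration sets $A\subseteq(\{0,1\}^n)^{B_n}$, and $d_w([\alpha],[\beta])=0$ if there is no such $n$. Then $\mathrm{Free}(\Gamma)$ is compact with respect to $d_w$. Moreover, let $\alpha_1,\alpha_2,\dots$ be free Cantor actions of $\Gamma$ whose classes form a $d_w$-Cauchy sequence. Then there is a Cantor subshift $Y$, that is, a closed subset $Y\subseteq\mathcal{C}^\Gamma$, invariant under the shift $(\delta\cdot y)(\gamma)=y(\gamma\delta)$, homeomorphic to $\mathcal{C}$, and on which the shift action is free, such that $\lim_j[\alpha_j]$ exists and is the class of the shift action on $Y$ (transported to $\mathcal{C}$ by a homeomorphism), and such that for all $n,k\geq 1$ a set $A\subseteq(\{0,1\}^k)^{B_n}$ is a configuration set of $Y$ if and only if it is a configuration set of $\alpha_j$ for all but finitely many $j$. -/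

import Mathlib

open Filter Topology

namespace QualWeak

/-- The Cantor set `{0,1}^ℕ`. -/
abbrev Cantor : Type := ℕ → Bool

/-- A free action of `Γ` on the Cantor set by homeomorphisms: only the unit has a fixed point. -/
structure FreeCantorAction (Γ : Type*) [Group Γ] where
  act : Γ →* (Cantor ≃ₜ Cantor)
  free : ∀ (γ : Γ) (x : Cantor), act γ x = x → γ = 1

section Conf

variable {Γ : Type*} [Group Γ]

/-- The ball of radius `r` around the unit in the Cayley graph of `Γ` with respect to `S`. -/
def ball (S : Finset Γ) (r : ℕ) : Set Γ :=
  {γ | ∃ l : List Γ, l.length ≤ r ∧ (∀ s ∈ l, s ∈ S) ∧ l.prod = γ}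

theorem one_mem_ball (S : Finset Γ) (r : ℕ) : (1 : Γ) ∈ ball S r :=
  ⟨[], by simp, by simp, by simp⟩

theorem ball_mono (S : Finset Γ) {m n : ℕ} (h : m ≤ n) : ball S m ⊆ ball S n := by
  rintro γ ⟨l, hl, hs, hp⟩
  exact ⟨l, hl.trans h, hs, hp⟩

/-- The pattern `γ ↦ φ (γ · x)` on the ball of radius `r`, for a `Γ`-action `a` on `X`
and a labelling `φ : X → Q`. -/
def pattern (S : Finset Γ) {X Q : Type*} (a : Γ → X → X) (r : ℕ) (φ : X → Q) (x : X) :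
    ball S r → Q :=
  fun γ => φ (a γ x)

/-- The set `Conf_r(φ)` of all patterns of radius `r` that occur in the labelling `φ`. -/
def Conf (S : Finset Γ) {X Q : Type*} (a : Γ → X → X) (r : ℕ) (φ : X → Q) :
    Set (ball S r → Q) :=
  Set.range (pattern S a r φ)

/-- The sets of patterns `A ⊆ ({0,1}^k)^{B_r}` that are of the form `A = Conf_r(φ)` for a
continuous `φ : X → {0,1}^k`. -/
def ConfFamily (S : Finset Γ) {X : Type*} [TopologicalSpace X] (a : Γ → X → X) (r k : ℕ) :
    Set (Set (ball S r → (Fin k → Bool))) :=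
  {A | ∃ φ : X → (Fin k → Bool), Continuous φ ∧ Conf S a r φ = A}

theorem conf_comp (S : Finset Γ) {X Q Q' : Type*} (a : Γ → X → X) {m n : ℕ} (h : m ≤ n)
    (φ : X → Q) (g : Q → Q') :
    Conf S a m (g ∘ φ) =
      (fun (τ : ball S n → Q) (γ : ball S m) => g (τ ⟨γ.1, ball_mono S h γ.2⟩)) ''
        Conf S a n φ := by
  unfold Conf
  rw [← Set.range_comp]
  rfl

end Conf

namespace FreeCantorAction

variable {Γ : Type*} [Group Γ]

/-- The action as a map `Γ → Cantor → Cantor`. -/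
def map (α : FreeCantorAction Γ) (γ : Γ) (x : Cantor) : Cantor := α.act γ x

/-- `α` qualitatively weakly contains `β`. -/
def WeaklyContains (S : Finset Γ) (α β : FreeCantorAction Γ) : Prop :=
  ∀ (Q : Type) [Finite Q] [TopologicalSpace Q] [DiscreteTopology Q] (ψ : Cantor → Q),
    Continuous ψ → ∀ r : ℕ, 0 < r →
      ∃ φ : Cantor → Q, Continuous φ ∧ Conf S α.map r φ = Conf S β.map r ψ

/-- `α` and `β` are qualitatively weakly equivalent. -/
def WeaklyEquiv (S : Finset Γ) (α β : FreeCantorAction Γ) : Prop :=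
  WeaklyContains S α β ∧ WeaklyContains S β α

theorem WeaklyContains.refl (S : Finset Γ) (α : FreeCantorAction Γ) : WeaklyContains S α α :=
  fun _ _ _ _ ψ hψ _ _ => ⟨ψ, hψ, rfl⟩

theorem WeaklyContains.trans {S : Finset Γ} {α β δ : FreeCantorAction Γ}
    (h₁ : WeaklyContains S α β) (h₂ : WeaklyContains S β δ) : WeaklyContains S α δ := by
  intro Q _ _ _ ψ hψ r hr
  obtain ⟨φ, hφ, e⟩ := h₂ Q ψ hψ r hr
  obtain ⟨χ, hχ, e'⟩ := h₁ Q φ hφ r hr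
  exact ⟨χ, hχ, e'.trans e⟩

/-- Qualitative weak equivalence as an equivalence relation. -/
def weakSetoid (S : Finset Γ) : Setoid (FreeCantorAction Γ) where
  r := WeaklyEquiv S
  iseqv :=
    ⟨fun α => ⟨.refl S α, .refl S α⟩, fun h => ⟨h.2, h.1⟩,
      fun h₁ h₂ => ⟨h₁.1.trans h₂.1, h₂.2.trans h₁.2⟩⟩

theorem WeaklyContains.confFamily_subset {S : Finset Γ} {α β : FreeCantorAction Γ}
    (h : WeaklyContains S α β) {r : ℕ} (hr : 1 ≤ r) (k : ℕ) :
    ConfFamily S β.map r k ⊆ ConfFamily S α.map r k := by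
  rintro A ⟨ψ, hψ, rfl⟩
  exact h (Fin k → Bool) ψ hψ r hr

theorem WeaklyEquiv.confFamily_eq {S : Finset Γ} {α β : FreeCantorAction Γ}
    (h : WeaklyEquiv S α β) {r : ℕ} (hr : 1 ≤ r) (k : ℕ) :
    ConfFamily S α.map r k = ConfFamily S β.map r k :=
  (h.2.confFamily_subset hr k).antisymm (h.1.confFamily_subset hr k)

theorem weaklyContains_of_confFamily {S : Finset Γ} {α β : FreeCantorAction Γ}
    (h : ∀ n, 1 ≤ n → ConfFamily S β.map n n ⊆ ConfFamily S α.map n n) :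
    WeaklyContains S α β := by
  intro Q _ _ _ ψ hψ r hr
  have : Nonempty Q := ⟨ψ fun _ => false⟩
  classical
  have := Fintype.ofFinite Q
  set n := max r (Fintype.card Q) with hn
  have hrn : r ≤ n := le_max_left _ _
  obtain ⟨e⟩ : Nonempty (Q ↪ (Fin n → Bool)) := by
    rw [Function.Embedding.nonempty_iff_card_le]
    have h1 : Fintype.card Q ≤ n := le_max_right _ _
    have h2 : n < 2 ^ n := Nat.lt_two_pow_self
    simp only [Fintype.card_pi, Fintype.card_bool, Finset.prod_const, Finset.card_univ,
      Fintype.card_fin]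
    omega
  obtain ⟨φ', hφ', hc⟩ := h n (hr.trans_le hrn)
    ⟨e ∘ ψ, (continuous_of_discreteTopology (f := e)).comp hψ, rfl⟩
  let g : (Fin n → Bool) → Q := Function.invFun e
  have hg : ∀ q, g (e q) = q := Function.leftInverse_invFun e.injective
  refine ⟨g ∘ φ', (continuous_of_discreteTopology (f := g)).comp hφ', ?_⟩
  have hψe : ψ = g ∘ (e ∘ ψ) := by
    funext x
    simp [hg]
  rw [conf_comp S α.map hrn φ' g, hc, ← conf_comp S β.map hrn (e ∘ ψ) g, ← hψe]

/-- The indices `n ≥ 1` at which the families of sets of patterns of `α` and `β` in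
`({0,1}^n)^{B_n}` differ. -/
def diffSet (S : Finset Γ) (α β : FreeCantorAction Γ) : Set ℕ :=
  {n | 1 ≤ n ∧ ConfFamily S α.map n n ≠ ConfFamily S β.map n n}

open Classical in
/-- The weak distance of two free Cantor actions: `2^{-n}` for the smallest `n ≥ 1` at which
they differ, and `0` if they do not differ. -/
noncomputable def weakDist (S : Finset Γ) (α β : FreeCantorAction Γ) : ℝ :=
  if (diffSet S α β).Nonempty then (1 / 2 : ℝ) ^ sInf (diffSet S α β) else 0

theorem weakDist_nonneg (S : Finset Γ) (α β : FreeCantorAction Γ) : 0 ≤ weakDist S α β := by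
  unfold weakDist
  split_ifs <;> positivity

theorem weakDist_comm (S : Finset Γ) (α β : FreeCantorAction Γ) :
    weakDist S α β = weakDist S β α := by
  have : diffSet S α β = diffSet S β α := by
    ext n
    simp only [diffSet, Set.mem_ofPred_eq, ne_comm]
  unfold weakDist
  rw [this]

theorem le_weakDist {S : Finset Γ} {α β : FreeCantorAction Γ} {n : ℕ}
    (h : n ∈ diffSet S α β) : (1 / 2 : ℝ) ^ n ≤ weakDist S α β := by
  rw [weakDist, if_pos ⟨n, h⟩]
  exact pow_le_pow_of_le_one (by norm_num) (by norm_num) (Nat.sInf_le h)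

theorem weakDist_triangle (S : Finset Γ) (α β δ : FreeCantorAction Γ) :
    weakDist S α δ ≤ weakDist S α β + weakDist S β δ := by
  have h₁ := weakDist_nonneg S α β
  have h₂ := weakDist_nonneg S β δ
  by_cases hne : (diffSet S α δ).Nonempty
  · have hm := Nat.sInf_mem hne
    have he : weakDist S α δ = (1 / 2 : ℝ) ^ sInf (diffSet S α δ) := if_pos hne
    by_cases hb : ConfFamily S α.map (sInf (diffSet S α δ)) (sInf (diffSet S α δ)) =
        ConfFamily S β.map (sInf (diffSet S α δ)) (sInf (diffSet S α δ))
    · have := le_weakDist (S := S) (α := β) (β := δ) ⟨hm.1, hb ▸ hm.2⟩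
      linarith
    · have := le_weakDist (S := S) (α := α) (β := β) ⟨hm.1, hb⟩
      linarith
  · have he : weakDist S α δ = 0 := if_neg hne
    linarith

theorem weaklyEquiv_of_weakDist_eq_zero {S : Finset Γ} {α β : FreeCantorAction Γ}
    (h : weakDist S α β = 0) : WeaklyEquiv S α β := by
  have key : ∀ n, 1 ≤ n → ConfFamily S α.map n n = ConfFamily S β.map n n := by
    intro n hn
    by_contra hne
    have h₁ := le_weakDist (S := S) (α := α) (β := β) ⟨hn, hne⟩
    have h₂ : (0 : ℝ) < (1 / 2 : ℝ) ^ n := by positivity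
    linarith
  exact ⟨weaklyContains_of_confFamily fun n hn => (key n hn).ge,
    weaklyContains_of_confFamily fun n hn => (key n hn).le⟩

theorem weakDist_self (S : Finset Γ) (α : FreeCantorAction Γ) : weakDist S α α = 0 :=
  if_neg fun ⟨_, hn⟩ => hn.2 rfl

theorem weakDist_congr {S : Finset Γ} {α β α' β' : FreeCantorAction Γ}
    (h₁ : WeaklyEquiv S α α') (h₂ : WeaklyEquiv S β β') :
    weakDist S α β = weakDist S α' β' := by
  have : diffSet S α β = diffSet S α' β' := by
    ext n
    simp only [diffSet, Set.mem_ofPred_eq]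
    refine and_congr_right fun hn => ?_
    rw [h₁.confFamily_eq hn, h₂.confFamily_eq hn]
  unfold weakDist
  rw [this]

end FreeCantorAction

open FreeCantorAction

/-- The set `Free(Γ)` of qualitative weak equivalence classes of free Cantor actions of `Γ`
(with respect to the generating set `S`). -/
def Free {Γ : Type*} [Group Γ] (S : Finset Γ) : Type _ := Quotient (weakSetoid S)

section Space

variable {Γ : Type*} [Group Γ]

/-- The class of a free Cantor action. -/
def cls (S : Finset Γ) (α : FreeCantorAction Γ) : Free S := Quotient.mk (weakSetoid S) α

/-- The weak distance of two classes. -/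
noncomputable def dw (S : Finset Γ) : Free S → Free S → ℝ :=
  Quotient.lift₂ (weakDist S) fun _ _ _ _ h₁ h₂ => weakDist_congr h₁ h₂

/-- `Free(Γ)` with the metric `dw`. -/
noncomputable instance freeMetricSpace (S : Finset Γ) : MetricSpace (Free S) where
  dist := dw S
  dist_self x := by
    induction x using Quotient.inductionOn
    exact weakDist_self S _
  dist_comm x y := by
    induction x, y using Quotient.inductionOn₂
    exact weakDist_comm S _ _
  dist_triangle x y z := by
    induction x, y, z using Quotient.inductionOn₃
    exact weakDist_triangle S _ _ _
  eq_of_dist_eq_zero {x y} h := by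
    induction x, y using Quotient.inductionOn₂
    exact Quotient.sound (s := weakSetoid S) (weaklyEquiv_of_weakDist_eq_zero h)

/-- The shift action of `Γ` on `Cantor^Γ`. -/
def shift (δ : Γ) (y : Γ → Cantor) : Γ → Cantor := fun γ => y (γ * δ)

/-- Cantor subshifts: closed shift-invariant subsets of `Cantor^Γ` that are homeomorphic to the
Cantor set and on which the shift action is free. -/
structure CantorSubshift (Γ : Type*) [Group Γ] where
  carrier : Set (Γ → Cantor)
  isClosed : IsClosed carrier
  shift_mem : ∀ (δ : Γ), ∀ y ∈ carrier, shift δ y ∈ carrier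
  homeo : Nonempty (carrier ≃ₜ Cantor)
  free : ∀ (δ : Γ), ∀ y ∈ carrier, shift δ y = y → δ = 1

/-- The shift action restricted to a Cantor subshift. -/
def CantorSubshift.map (Y : CantorSubshift Γ) (δ : Γ) (y : Y.carrier) : Y.carrier :=
  ⟨shift δ y.1, Y.shift_mem δ y.1 y.2⟩

/-- The free Cantor action `α` is conjugate to the shift action on `Y`. -/
def CantorSubshift.IsConj (Y : CantorSubshift Γ) (α : FreeCantorAction Γ) : Prop :=
  ∃ h : Y.carrier ≃ₜ Cantor, ∀ (δ : Γ) (y : Y.carrier), h (Y.map δ y) = α.map δ (h y)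

/-- A set `A` of patterns is surviving for a sequence of free Cantor actions if it is of the form
`Conf_n(φ_j)`, with `φ_j` continuous, for all but finitely many members of the sequence. -/
def Surviving (S : Finset Γ) (α : ℕ → FreeCantorAction Γ) (n k : ℕ)
    (A : Set (ball S n → (Fin k → Bool))) : Prop :=
  ∀ᶠ j in atTop, A ∈ ConfFamily S (α j).map n k

end Space

end QualWeak

/-!
Labelling the points of a free Cantor action `α` by elements of the Cantor set yields an equivariant
map into the shift on `Cantor^Γ`, whose image is a point of the compact Vietoris hyperspace.
Choose labels that contain, for every configuration set of `α`, a labelling realizing it; for every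
`δ ≠ 1`, a coloring with four colors in which `x` and `δ x` never agree; and infinitely many bits,
each taking both values on every fibre of a finite window of the earlier labels.

Let `Z` be the limit of the images along an ultrafilter. A continuous map into a discrete space has
the same image on `Z` as on almost all terms. Hence a continuous labelling of `Z`, extended to
`Cantor^Γ`, has the same configuration set on almost all terms, and conversely the recorded
labellings carry over to `Z`; the colorings make the shift on `Z` free; the splitting bits make `Z`
perfect, so that it is a Cantor set by Brouwer's theorem. Convergence for `d_w` means that every
family of configuration sets is eventually constant, so every ultrafilter on `Free(Γ)` converges,
and a Cauchy sequence converges to its ultralimit.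
-/

namespace QualWeak

section Topology

variable {X Q : Type*} [TopologicalSpace X] [TopologicalSpace Q]

theorem perfectSpace_of_forall_exists_tendsto
    (h : ∀ x : X, ∃ u : ℕ → X, (∀ n, u n ≠ x) ∧ Tendsto u atTop (𝓝 x)) : PerfectSpace X := by
  refine perfectSpace_iff_forall_not_isolated.2 fun x => ?_
  obtain ⟨u, hne, hu⟩ := h x
  exact (tendsto_nhdsWithin_iff.2 ⟨hu, Eventually.of_forall hne⟩).neBot

instance Cantor.perfectSpace : PerfectSpace Cantor := by
  refine perfectSpace_of_forall_exists_tendsto fun x =>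
    ⟨fun n => Function.update x n (!x n), fun n => by simp, tendsto_pi_nhds.2 fun i => ?_⟩
  refine tendsto_nhds_of_eventually_eq ?_
  filter_upwards [eventually_gt_atTop i] with n hn
  exact Function.update_of_ne hn.ne _ _

theorem exists_continuous_extend_of_isClosed [CompactSpace X] [T2Space X]
    [TotallyDisconnectedSpace X] [Finite Q] [T2Space Q] [Nonempty Q] {Z : Set X} (hZ : IsClosed Z)
    (φ : C(Z, Q)) : ∃ ψ : C(X, Q), ∀ z : Z, ψ z = φ z := by
  have := isCompact_iff_compactSpace.1 hZ.isCompact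
  obtain ⟨ψ, hψ, -, h⟩ := Profinite.exists_lift_of_finite_of_injective_of_surjective
    ((↑) : Z → X) continuous_subtype_val Subtype.val_injective
    (fun _ : Q => ()) (Function.surjective_to_subsingleton _) φ φ.continuous (fun _ => ())
    continuous_const rfl
  exact ⟨⟨ψ, hψ⟩, congrFun h⟩

/-- A two-valued map `u` splits the fibres of `P` if it takes both values on each of them. A label
that splits the fibres of all earlier labels is the device by which isolated points are avoided. -/
def SplitsFibres {X Q : Type*} (P : X → Q) (u : X → Bool) : Prop :=
  ∀ x c, ∃ x', P x' = P x ∧ u x' = c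

theorem exists_continuous_bool_split [TotallySeparatedSpace X] [PerfectSpace X] {V : Set X}
    (hV : IsOpen V) (hne : V.Nonempty) : ∃ u : C(X, Bool), ∀ c, ∃ x ∈ V, u x = c := by
  obtain ⟨x, hx⟩ := hne
  obtain ⟨y, ⟨hy, -⟩, hyx⟩ :=
    preperfect_iff_nhds.1 PerfectSpace.univ_preperfect x (Set.mem_univ x) V (hV.mem_nhds hx)
  obtain ⟨D, hD, hyD, hxD⟩ := exists_isClopen_of_totally_separated hyx
  refine ⟨⟨D.boolIndicator, (continuous_boolIndicator_iff_isClopen D).2 hD⟩, ?_⟩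
  rintro (_ | _)
  exacts [⟨x, hx, (D.notMem_iff_boolIndicator x).1 hxD⟩, ⟨y, hy, (D.mem_iff_boolIndicator y).1 hyD⟩]

theorem exists_continuous_bool_split_refining [TotallySeparatedSpace X] [PerfectSpace X]
    {V : Set X} (hV : IsOpen V) (b : C(X, Bool)) :
    ∃ u : C(X, Bool), (V.Nonempty → ∀ c, ∃ x ∈ V, u x = c) ∧
      ∀ x ∈ V, ∀ x' ∈ V, u x = u x' → b x = b x' := by
  rcases V.eq_empty_or_nonempty with rfl | hne
  · exact ⟨b, by simp⟩
  by_cases hb : ∀ c, ∃ x ∈ V, b x = c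
  · exact ⟨b, fun _ => hb, fun _ _ _ _ h => h⟩
  obtain ⟨u, hu⟩ := exists_continuous_bool_split hV hne
  push Not at hb
  obtain ⟨c, hc⟩ := hb
  exact ⟨u, fun _ => hu, fun x hx x' hx' _ =>
    (Bool.eq_not.2 (hc x hx)).trans (Bool.eq_not.2 (hc x' hx')).symm⟩

theorem exists_splitsFibres [TotallySeparatedSpace X] [PerfectSpace X] [DiscreteTopology Q]
    (P : C(X, Q)) (b : C(X, Bool)) :
    ∃ u : C(X, Bool), SplitsFibres P u ∧
      ∀ x x', P x = P x' → u x = u x' → b x = b x' := by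
  choose v hsplit hrefine using fun q : Q =>
    exists_continuous_bool_split_refining ((isOpen_discrete {q}).preimage P.continuous) b
  refine ⟨⟨fun x => v (P x) x, ?_⟩, fun x c => ?_, fun x x' hP hu => ?_⟩
  · exact (continuous_prod_of_discrete_left (f := fun p : Q × X => v p.1 p.2)).2
      (fun q => (v q).continuous) |>.comp (P.continuous.prodMk continuous_id)
  · obtain ⟨x', hx', hc⟩ := hsplit (P x) ⟨x, rfl⟩ c
    exact ⟨x', hx', (congrArg (v · x') hx').trans hc⟩
  · exact hrefine (P x) x rfl x' hP.symm (hu.trans (congrArg (v · x') hP.symm))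

theorem exists_seq_of_forall_prefix {β : Type*} (p : ∀ n, (Fin n → β) → β → Prop)
    (h : ∀ n w, ∃ b, p n w b) : ∃ w : ℕ → β, ∀ n, p n (fun i => w i) (w n) := by
  choose f hf using h
  let w : ℕ → β := Nat.strongRec fun n w => f n fun i => w i i.2
  refine ⟨w, fun n => ?_⟩
  have hw : w n = f n fun i => w i := Nat.strongRec_eq _ n
  exact hw ▸ hf n _

theorem exists_seq_continuous_bool_separating [CompactSpace X] [T2Space X]
    [SecondCountableTopology X] [TotallyDisconnectedSpace X] :
    ∃ b : ℕ → C(X, Bool), ∀ x x', (∀ n, b n x = b n x') → x = x' := by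
  have : Countable (TopologicalSpace.Clopens X) :=
    TopologicalSpace.Clopens.countable_iff_secondCountable.2 inferInstance
  obtain ⟨C, hC⟩ := exists_surjective_nat (TopologicalSpace.Clopens X)
  refine ⟨fun n => ⟨(C n : Set X).boolIndicator,
    (continuous_boolIndicator_iff_isClopen _).2 (C n).isClopen⟩, fun x x' h => ?_⟩
  have hclopen : ∀ D : TopologicalSpace.Clopens X,
      (D : Set X).boolIndicator x = (D : Set X).boolIndicator x' := hC.forall.2 h
  by_contra hne
  obtain ⟨D, hD, hx, hx'⟩ := exists_isClopen_of_totally_separated hne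
  have hD_eq : D.boolIndicator x = D.boolIndicator x' := hclopen ⟨D, hD⟩
  exact hx' ((D.mem_iff_boolIndicator x').2 (hD_eq ▸ (D.mem_iff_boolIndicator x).1 hx))

/-- **Brouwer's theorem**. The coordinates of the homeomorphism are chosen one after the other: each
one splits the fibres of the previous ones, which gives surjectivity, and refines the next member of
a separating sequence, which gives injectivity. -/
theorem nonempty_homeomorph_cantor [CompactSpace X] [T2Space X] [SecondCountableTopology X]
    [TotallyDisconnectedSpace X] [PerfectSpace X] [Nonempty X] : Nonempty (X ≃ₜ Cantor) := by
  obtain ⟨b, hb⟩ := exists_seq_continuous_bool_separating (X := X)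
  obtain ⟨u, hu⟩ := exists_seq_of_forall_prefix _ fun n (w : Fin n → C(X, Bool)) =>
    exists_splitsFibres (ContinuousMap.pi w) (b n)
  let code (x : X) : Cantor := fun n => u n x
  have code_continuous : Continuous code := continuous_pi fun n => (u n).continuous
  have code_injective : Function.Injective code := fun x x' h =>
    hb x x' fun n => (hu n).2 x x' (funext fun i => congrFun h i) (congrFun h n)
  have prefix_realized (c : Cantor) (n : ℕ) : ∃ x, ∀ i < n, code x i = c i := by
    induction n with
    | zero => exact ⟨Classical.arbitrary X, by simp⟩
    | succ n ih =>
      obtain ⟨x, hx⟩ := ih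
      obtain ⟨x', hx', hc⟩ := (hu n).1 x (c n)
      refine ⟨x', fun i hi => (Nat.lt_succ_iff_lt_or_eq.1 hi).elim (fun hin => ?_) ?_⟩
      · exact (congrFun hx' ⟨i, hin⟩).trans (hx i hin)
      · rintro rfl
        exact hc
  have code_surjective : Function.Surjective code := by
    intro c
    choose x hx using prefix_realized c
    have lim : Tendsto (fun n => code (x n)) atTop (𝓝 c) := tendsto_pi_nhds.2 fun i =>
      tendsto_nhds_of_eventually_eq ((eventually_gt_atTop i).mono fun n hn => hx n i hn)
    exact (isCompact_range code_continuous).isClosed.mem_of_tendsto lim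
      (Eventually.of_forall fun n => Set.mem_range_self _)
  exact ⟨Continuous.homeoOfEquivCompactToT2
    (f := Equiv.ofBijective code ⟨code_injective, code_surjective⟩) code_continuous⟩

/-- A partial coloring of `X` by the nonzero elements of `{0,1}^2`, with `0` for points without a
color, in which `x` and `T x` never share a color. Three colors suffice to extend it greedily, since
a point only has to avoid the colors of `T x` and `T⁻¹ x`. -/
def IsPartialColoring {X : Type*} (T : X → X) (c : X → (Fin 2 → Bool)) : Prop :=
  ∀ x, c x ≠ 0 → c (T x) ≠ c x

theorem exists_fresh_color (p q : Fin 2 → Bool) : ∃ r, r ≠ 0 ∧ r ≠ p ∧ r ≠ q := by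
  revert p q
  decide

theorem IsPartialColoring.exists_extend {T : X ≃ₜ X} {V : Set X} (hV : IsClopen V)
    (hTV : ∀ x ∈ V, T x ∉ V) {c : X → (Fin 2 → Bool)} (hc : Continuous c)
    (h : IsPartialColoring T c) :
    ∃ c' : X → (Fin 2 → Bool), Continuous c' ∧ IsPartialColoring T c' ∧
      (∀ x, c x ≠ 0 → c' x ≠ 0) ∧ ∀ x ∈ V, c' x ≠ 0 := by
  classical
  choose fresh fresh_ne_zero fresh_ne_left fresh_ne_right using exists_fresh_color
  let c' (x : X) : Fin 2 → Bool :=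
    if x ∈ V ∧ c x = 0 then fresh (c (T x)) (c (T.symm x)) else c x
  have hc'_pos {x} (hx : x ∈ V ∧ c x = 0) : c' x = fresh (c (T x)) (c (T.symm x)) := if_pos hx
  have hc'_neg {x} (hx : ¬(x ∈ V ∧ c x = 0)) : c' x = c x := if_neg hx
  refine ⟨c', ?_, fun x hx => ?_, fun x hx => ?_, fun x hx => ?_⟩
  · have hclopen : IsClopen (V ∩ c ⁻¹' {0}) := hV.inter ((isClopen_discrete _).preimage hc)
    refine Continuous.if (fun x hx => ?_) ?_ hc
    · exact absurd (hclopen.frontier_eq ▸ hx) (Set.notMem_empty x)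
    · exact (continuous_of_discreteTopology (f := fun p : (Fin 2 → Bool) × (Fin 2 → Bool) =>
        fresh p.1 p.2)).comp ((hc.comp T.continuous).prodMk (hc.comp T.symm.continuous))
  · by_cases h₁ : x ∈ V ∧ c x = 0
    · rw [hc'_pos h₁, hc'_neg fun h₂ => hTV x h₁.1 h₂.1]
      exact (fresh_ne_left _ _).symm
    · rw [hc'_neg h₁] at hx ⊢
      by_cases h₂ : T x ∈ V ∧ c (T x) = 0
      · rw [hc'_pos h₂, T.symm_apply_apply]
        exact fresh_ne_right _ _
      · rw [hc'_neg h₂]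
        exact h x hx
  · rwa [hc'_neg fun h => hx h.2]
  · by_cases h₀ : c x = 0
    · exact hc'_pos ⟨hx, h₀⟩ ▸ fresh_ne_zero _ _
    · rwa [hc'_neg fun h => h₀ h.2]

theorem exists_isClopen_disjoint_image [CompactSpace X] [T2Space X] [TotallyDisconnectedSpace X]
    {T : X → X} (hT : Continuous T) {x : X} (hx : T x ≠ x) :
    ∃ V : Set X, IsClopen V ∧ x ∈ V ∧ ∀ y ∈ V, T y ∉ V := by
  obtain ⟨D, hD, hTx, hxD⟩ := exists_isClopen_of_totally_separated hx
  exact ⟨Dᶜ ∩ T ⁻¹' D, hD.compl.inter (hD.preimage hT), ⟨hxD, hTx⟩, fun y hy h => h.1 hy.2⟩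

theorem exists_coloring_of_forall_ne [CompactSpace X] [T2Space X] [TotallyDisconnectedSpace X]
    (T : X ≃ₜ X) (hT : ∀ x, T x ≠ x) :
    ∃ c : X → (Fin 2 → Bool), Continuous c ∧ ∀ x, c (T x) ≠ c x := by
  have extend_to_univ : ∀ c : X → (Fin 2 → Bool), Continuous c → IsPartialColoring T c →
      ∃ c' : X → (Fin 2 → Bool), Continuous c' ∧ IsPartialColoring T c' ∧
        (∀ x, c x ≠ 0 → c' x ≠ 0) ∧ ∀ x ∈ Set.univ, c' x ≠ 0 := by
    refine isCompact_univ.induction_on ?_ ?_ ?_ ?_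
    · exact fun c hc h => ⟨c, hc, h, fun _ => id, fun x hx => hx.elim⟩
    · intro s t hst ht c hc h
      obtain ⟨c', hc', h', hext, hdom⟩ := ht c hc h
      exact ⟨c', hc', h', hext, fun x hx => hdom x (hst hx)⟩
    · intro s t hs ht c hc h
      obtain ⟨c₁, hc₁, h₁, hext₁, hdom₁⟩ := hs c hc h
      obtain ⟨c₂, hc₂, h₂, hext₂, hdom₂⟩ := ht c₁ hc₁ h₁
      exact ⟨c₂, hc₂, h₂, fun x hx => hext₂ x (hext₁ x hx),
        fun x hx => hx.elim (fun hxs => hext₂ x (hdom₁ x hxs)) (hdom₂ x)⟩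
    · intro x _
      obtain ⟨V, hV, hxV, hTV⟩ := exists_isClopen_disjoint_image T.continuous (hT x)
      exact ⟨V, mem_nhdsWithin_of_mem_nhds (hV.isOpen.mem_nhds hxV),
        fun c hc h => h.exists_extend hV hTV hc⟩
  obtain ⟨c, hc, h, -, hdom⟩ :=
    extend_to_univ 0 continuous_const fun x hx => absurd rfl hx
  exact ⟨c, hc, fun x => h x (hdom x (Set.mem_univ x))⟩

end Topology

section Limit

open TopologicalSpace

variable {X Q ι : Type*} [TopologicalSpace X]

theorem eventually_image_eq_of_tendsto [TopologicalSpace Q] [DiscreteTopology Q] {l : Filter ι}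
    {K : ι → NonemptyCompacts X} {L : NonemptyCompacts X} (h : Tendsto K l (𝓝 L)) (g : C(X, Q)) :
    ∀ᶠ i in l, g '' (K i : Set X) = g '' (L : Set X) := by
  have hmap := (g.continuous.nonemptyCompacts_map.tendsto L).comp h
  rw [nhds_discrete, tendsto_pure] at hmap
  exact hmap.mono fun i hi => SetLike.ext'_iff.1 hi

variable {l : Filter ι} [l.NeBot] {K : ι → NonemptyCompacts X} {L : NonemptyCompacts X}

theorem subset_of_tendsto_of_isClosed (h : Tendsto K l (𝓝 L)) {C : Set X} (hC : IsClosed C)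
    (hK : ∀ i, (K i : Set X) ⊆ C) : (L : Set X) ⊆ C :=
  (NonemptyCompacts.isClosed_subsets_of_isClosed hC).mem_of_tendsto h (Eventually.of_forall hK)

theorem image_eq_of_tendsto [T2Space X] (h : Tendsto K l (𝓝 L)) {f : X → X} (hf : Continuous f)
    (hK : ∀ i, f '' (K i : Set X) = K i) : f '' (L : Set X) = L := by
  have hmap := (hf.nonemptyCompacts_map.tendsto L).comp h
  have hmap_eq : NonemptyCompacts.map f hf ∘ K = K := funext fun i => SetLike.coe_injective (hK i)
  exact SetLike.ext'_iff.1 (tendsto_nhds_unique (hmap_eq ▸ hmap) h)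

theorem splitsFibres_of_tendsto [TopologicalSpace Q] [DiscreteTopology Q]
    (h : Tendsto K l (𝓝 L)) (P : C(X, Q)) (u : C(X, Bool))
    (hK : ∀ i, SplitsFibres (fun y : K i => P y) fun y => u y) :
    SplitsFibres (fun y : L => P y) fun y => u y := by
  intro y c
  obtain ⟨i, hi⟩ := (eventually_image_eq_of_tendsto h (P.prodMk u)).exists
  obtain ⟨y', hy', hyP⟩ : P.prodMk u y ∈ P.prodMk u '' (K i : Set X) :=
    hi ▸ Set.mem_image_of_mem _ y.2
  obtain ⟨z', hz'P, hz'c⟩ := hK i ⟨y', hy'⟩ c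
  obtain ⟨z, hz, hzP⟩ : P.prodMk u z' ∈ P.prodMk u '' (L : Set X) :=
    hi ▸ Set.mem_image_of_mem _ z'.2
  exact ⟨⟨z, hz⟩, (congrArg Prod.fst hzP).trans (hz'P.trans (congrArg Prod.fst hyP)),
    (congrArg Prod.snd hzP).trans hz'c⟩

end Limit

section Labels

variable {X : Type*} [TopologicalSpace X] [TotallySeparatedSpace X] [PerfectSpace X]

theorem exists_labels_splitting (a : ℕ → C(X, X)) (b : ℕ → C(X, Bool)) :
    ∃ w : ℕ → C(X, Bool), (∀ m, w (2 * m) = b m) ∧ ∀ n, Odd n →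
      SplitsFibres (fun x (p : Fin n × Fin n) => w p.2 (a p.1 x)) (w n) := by
  have exists_next (n : ℕ) (w : Fin n → C(X, Bool)) : ∃ u : C(X, Bool),
      (∀ m, n = 2 * m → u = b m) ∧
        (Odd n → SplitsFibres (fun x (p : Fin n × Fin n) => w p.2 (a p.1 x)) u) := by
    obtain ⟨m, rfl | rfl⟩ := n.even_or_odd'
    · exact ⟨b m, fun m' h => by rw [Nat.mul_left_cancel two_pos h],
        fun h => absurd h (Nat.not_odd_iff_even.2 (even_two_mul m))⟩
    · let window : C(X, Fin (2 * m + 1) × Fin (2 * m + 1) → Bool) :=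
        ContinuousMap.pi fun p => (w p.2).comp (a p.1)
      obtain ⟨u, hu, -⟩ := exists_splitsFibres window (ContinuousMap.const X true)
      exact ⟨u, fun m' h => by omega, fun _ => hu⟩
  obtain ⟨w, hw⟩ := exists_seq_of_forall_prefix _ exists_next
  exact ⟨w, fun m => (hw (2 * m)).1 m rfl, fun n => (hw n).2⟩

end Labels

section Encoding

variable {Γ : Type*} [Group Γ] {S : Finset Γ}

instance finite_ball (S : Finset Γ) (r : ℕ) : Finite (ball S r) := by
  refine ((List.finite_length_le S r).image fun l => (l.map Subtype.val).prod).subset ?_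
  rintro γ ⟨l, hl, hs, rfl⟩
  exact ⟨l.attachWith (· ∈ S) hs, by simpa using hl, by simp⟩

theorem continuous_shift (δ : Γ) : Continuous (shift δ) := by
  unfold shift
  fun_prop

theorem shift_mul (γ δ : Γ) (y : Γ → Cantor) : shift (γ * δ) y = shift γ (shift δ y) := by
  funext ε
  simp only [shift, mul_assoc]

theorem shift_one (y : Γ → Cantor) : shift 1 y = y := by
  funext ε
  simp only [shift, mul_one]

namespace FreeCantorAction

theorem continuous_map (α : FreeCantorAction Γ) (γ : Γ) : Continuous (α.map γ) :=
  (α.act γ).continuous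

protected theorem map_mul (α : FreeCantorAction Γ) (γ δ : Γ) (x : Cantor) :
    α.map (γ * δ) x = α.map γ (α.map δ x) := by
  simp only [map, map_mul, Homeomorph.mul_apply]

protected theorem map_one (α : FreeCantorAction Γ) (x : Cantor) : α.map 1 x = x := by
  simp only [map, map_one, Homeomorph.one_apply]

/-- The equivariant map into the shift on `Cantor^Γ` that records the values of `Φ` along the
orbits of `α`. -/
def itinerary (α : FreeCantorAction Γ) (Φ : C(Cantor, Cantor)) : C(Cantor, Γ → Cantor) where
  toFun x γ := Φ (α.map γ x)
  continuous_toFun := continuous_pi fun γ => Φ.continuous.comp (α.continuous_map γ)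

theorem itinerary_apply_one (α : FreeCantorAction Γ) (Φ : C(Cantor, Cantor)) (x : Cantor) :
    α.itinerary Φ x 1 = Φ x :=
  congrArg Φ (α.map_one x)

theorem shift_itinerary (α : FreeCantorAction Γ) (Φ : C(Cantor, Cantor)) (δ : Γ) (x : Cantor) :
    shift δ (α.itinerary Φ x) = α.itinerary Φ (α.map δ x) := by
  funext γ
  exact congrArg Φ (α.map_mul γ δ x)

/-- The set of itineraries, as a point of the Vietoris hyperspace of `Cantor^Γ`. -/
def itinerarySet (α : FreeCantorAction Γ) (Φ : C(Cantor, Cantor)) :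
    TopologicalSpace.NonemptyCompacts (Γ → Cantor) where
  carrier := Set.range (α.itinerary Φ)
  isCompact' := isCompact_range (α.itinerary Φ).continuous
  nonempty' := Set.range_nonempty _

theorem coe_itinerarySet (α : FreeCantorAction Γ) (Φ : C(Cantor, Cantor)) :
    (α.itinerarySet Φ : Set (Γ → Cantor)) = Set.range (α.itinerary Φ) :=
  rfl

theorem shift_image_itinerarySet (α : FreeCantorAction Γ) (Φ : C(Cantor, Cantor)) (δ : Γ) :
    shift δ '' (α.itinerarySet Φ : Set (Γ → Cantor)) = α.itinerarySet Φ := by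
  have hsurj : (α.map δ).Surjective := (α.act δ).surjective
  rw [coe_itinerarySet, ← Set.range_comp, ← hsurj.range_comp (α.itinerary Φ)]
  exact congrArg Set.range (funext (α.shift_itinerary Φ δ))

theorem pattern_image_itinerarySet {Q : Type*} (α : FreeCantorAction Γ) (Φ : C(Cantor, Cantor))
    (n : ℕ) (ψ : (Γ → Cantor) → Q) :
    pattern S shift n ψ '' (α.itinerarySet Φ : Set (Γ → Cantor)) =
      Conf S α.map n (ψ ∘ α.itinerary Φ) := by
  rw [coe_itinerarySet, ← Set.range_comp]
  refine congrArg Set.range (funext₂ fun x γ => ?_)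
  exact congrArg ψ (α.shift_itinerary Φ γ x)

theorem exists_coloring (α : FreeCantorAction Γ) {δ : Γ} (hδ : δ ≠ 1) :
    ∃ c : Cantor → (Fin 2 → Bool), Continuous c ∧ ∀ x, c (α.map δ x) ≠ c x :=
  exists_coloring_of_forall_ne (α.act δ) fun x hx => hδ (α.free δ x hx)

end FreeCantorAction

theorem CantorSubshift.pattern_image_carrier {Q : Type*} (Y : CantorSubshift Γ) (n : ℕ)
    (ψ : (Γ → Cantor) → Q) :
    pattern S shift n ψ '' Y.carrier = Conf S Y.map n fun y => ψ y := by
  rw [Set.image_eq_range]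
  rfl

/-- The labels with even position in an encoding: the `k` bits of a labelling that realizes a given
set of patterns, and the two bits of a coloring that separates each point from its translate by a
given element of `Γ`. -/
abbrev LabelIndex (S : Finset Γ) : Type _ :=
  (Σ n k : ℕ, Set (ball S n → (Fin k → Bool)) × Fin k) ⊕ Γ × Fin 2

/-- A sequence `Φ` of labels which records the configuration sets of `α`, its freeness and the
absence of isolated points in a form that survives in limits of sets of itineraries. The label `i`
stands at position `2 * pos i`. The label at an odd position `n` splits the fibres of the window
formed by the labels at positions below `n`, read along the first `n` elements of the enumeration
`g` of `Γ`. -/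
structure IsEncoding (S : Finset Γ) (g : ℕ → Γ) (pos : LabelIndex S → ℕ)
    (α : FreeCantorAction Γ) (Φ : C(Cantor, Cantor)) : Prop where
  realizes : ∀ {n k : ℕ} {A : Set (ball S n → (Fin k → Bool))}, A ∈ ConfFamily S α.map n k →
    Conf S α.map n (fun x j => Φ x (2 * pos (.inl ⟨n, k, A, j⟩))) = A
  separates : ∀ {δ : Γ}, δ ≠ 1 → ∀ x, ∃ j : Fin 2,
    Φ (α.map δ x) (2 * pos (.inr (δ, j))) ≠ Φ x (2 * pos (.inr (δ, j)))
  splits : ∀ {n : ℕ}, Odd n →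
    SplitsFibres (fun x (p : Fin n × Fin n) => Φ (α.map (g p.1) x) p.2) fun x => Φ x n

theorem exists_isEncoding (S : Finset Γ) (g : ℕ → Γ) {pos : LabelIndex S → ℕ}
    (hpos : pos.Injective) (α : FreeCantorAction Γ) : ∃ Φ, IsEncoding S g pos α Φ := by
  have exists_labelling (n k : ℕ) (A : Set (ball S n → (Fin k → Bool))) :
      ∃ φ : C(Cantor, Fin k → Bool), A ∈ ConfFamily S α.map n k → Conf S α.map n φ = A := by
    by_cases hA : A ∈ ConfFamily S α.map n k
    · obtain ⟨φ, hφ, hφA⟩ := hA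
      exact ⟨⟨φ, hφ⟩, fun _ => hφA⟩
    · exact ⟨.const _ fun _ => false, fun h => absurd h hA⟩
  have exists_coloring (δ : Γ) :
      ∃ c : C(Cantor, Fin 2 → Bool), δ ≠ 1 → ∀ x, c (α.map δ x) ≠ c x := by
    by_cases hδ : δ = 1
    · exact ⟨.const _ fun _ => false, fun h => absurd hδ h⟩
    · obtain ⟨c, hc, hcδ⟩ := α.exists_coloring hδ
      exact ⟨⟨c, hc⟩, fun _ => hcδ⟩
  choose φ hφ using exists_labelling
  choose c hc using exists_coloring
  let label : LabelIndex S → C(Cantor, Bool) :=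
    Sum.elim (fun i => (ContinuousMap.eval i.2.2.2).comp (φ i.1 i.2.1 i.2.2.1))
      fun i => (ContinuousMap.eval i.2).comp (c i.1)
  obtain ⟨w, hw_even, hw_odd⟩ := exists_labels_splitting
    (fun m => ⟨α.map (g m), α.continuous_map (g m)⟩)
    (Function.extend pos label fun _ => .const _ false)
  have hw (i : LabelIndex S) : w (2 * pos i) = label i := by
    rw [hw_even, hpos.extend_apply]
  refine ⟨ContinuousMap.pi w, fun hA => ?_, fun hδ x => ?_, fun hn => hw_odd _ hn⟩
  · simp only [ContinuousMap.pi_eval, hw]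
    exact hφ _ _ _ hA
  · simp only [ContinuousMap.pi_eval, hw]
    exact Function.ne_iff.1 (hc _ hδ x)

end Encoding

section Ultralimit

open TopologicalSpace FreeCantorAction

variable {Γ : Type*} [Group Γ] {S : Finset Γ} {g : ℕ → Γ}

theorem perfectSpace_of_splitsFibres (hg : g.Surjective) {Z : Set (Γ → Cantor)}
    (hZ : ∀ n, Odd n → SplitsFibres
      (fun (y : Z) (p : Fin n × Fin n) => y.1 (g p.1) p.2) fun y => y.1 1 n) :
    PerfectSpace Z := by
  refine perfectSpace_of_forall_exists_tendsto fun y => ?_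
  choose z hz_window hz_flip using fun m => hZ (2 * m + 1) (odd_two_mul_add_one m) y
    (!y.1 1 (2 * m + 1))
  refine ⟨z, fun m hm => Bool.not_ne_self (y.1 1 (2 * m + 1)) ?_, tendsto_subtype_rng.2 ?_⟩
  · rw [← hz_flip m, hm]
  · refine tendsto_pi_nhds.2 fun γ => tendsto_pi_nhds.2 fun i => ?_
    obtain ⟨j, rfl⟩ := hg γ
    refine tendsto_const_nhds.congr' ?_
    filter_upwards [eventually_ge_atTop (max i j)] with m hm
    exact (congrFun (hz_window m) (⟨j, by omega⟩, ⟨i, by omega⟩)).symm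

variable {ι : Type*} {l : Filter ι} {α : ι → FreeCantorAction Γ} {Φ : ι → C(Cantor, Cantor)}

theorem eventually_conf_itinerary_eq {Q : Type*} [Finite Q] [TopologicalSpace Q]
    [DiscreteTopology Q] {Y : CantorSubshift Γ} {Z : NonemptyCompacts (Γ → Cantor)}
    (hlim : Tendsto (fun i => (α i).itinerarySet (Φ i)) l (𝓝 Z)) (hYZ : Y.carrier = Z) (n : ℕ)
    (ψ : C(Γ → Cantor, Q)) :
    ∀ᶠ i in l, Conf S (α i).map n (ψ ∘ (α i).itinerary (Φ i)) =
      Conf S Y.map n fun y => ψ y := by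
  let p : C(Γ → Cantor, ball S n → Q) :=
    ⟨pattern S shift n ψ, continuous_pi fun γ => ψ.continuous.comp (continuous_shift γ.1)⟩
  filter_upwards [eventually_image_eq_of_tendsto hlim p] with i hi
  rw [← pattern_image_itinerarySet, ← Y.pattern_image_carrier, hYZ]
  exact hi

variable {pos : LabelIndex S → ℕ}

theorem shift_ne_of_tendsto_itinerarySet [l.NeBot] (hΦ : ∀ i, IsEncoding S g pos (α i) (Φ i))
    {Z : NonemptyCompacts (Γ → Cantor)}
    (hlim : Tendsto (fun i => (α i).itinerarySet (Φ i)) l (𝓝 Z)) {δ : Γ} (hδ : δ ≠ 1)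
    {y : Γ → Cantor} (hy : y ∈ Z) : shift δ y ≠ y := by
  let bits (γ : Γ) (y : Γ → Cantor) : Fin 2 → Bool := fun j => y γ (2 * pos (.inr (δ, j)))
  have hbits (γ : Γ) : Continuous (bits γ) := by fun_prop
  have hclosed : IsClosed {y | bits δ y ≠ bits 1 y} :=
    (isClosed_discrete {p : (Fin 2 → Bool) × (Fin 2 → Bool) | p.1 ≠ p.2}).preimage
      ((hbits δ).prodMk (hbits 1))
  have hsubset : (Z : Set (Γ → Cantor)) ⊆ {y | bits δ y ≠ bits 1 y} := by
    refine subset_of_tendsto_of_isClosed hlim hclosed ?_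
    rintro i - ⟨x, rfl⟩
    obtain ⟨j, hj⟩ := (hΦ i).separates hδ x
    refine Function.ne_iff.2 ⟨j, ?_⟩
    simp only [bits, itinerary_apply_one]
    exact hj
  intro hfix
  have hy_one : y δ = y 1 := by simpa only [shift, one_mul] using congrFun hfix 1
  exact hsubset hy (funext fun j => congrFun hy_one _)

theorem perfectSpace_of_tendsto_itinerarySet [l.NeBot] (hg : g.Surjective)
    (hΦ : ∀ i, IsEncoding S g pos (α i) (Φ i)) {Z : NonemptyCompacts (Γ → Cantor)}
    (hlim : Tendsto (fun i => (α i).itinerarySet (Φ i)) l (𝓝 Z)) : PerfectSpace Z := by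
  refine perfectSpace_of_splitsFibres hg fun n hn => splitsFibres_of_tendsto hlim
    ⟨fun y (p : Fin n × Fin n) => y (g p.1) p.2, by fun_prop⟩ ⟨fun y => y 1 n, by fun_prop⟩ ?_
  rintro i ⟨-, x, rfl⟩ c
  obtain ⟨x', hx', hx'c⟩ := (hΦ i).splits hn x c
  refine ⟨⟨_, x', rfl⟩, hx', ?_⟩
  exact (congrFun ((α i).itinerary_apply_one (Φ i) x') n).trans hx'c

theorem exists_cantorSubshift_of_tendsto_itinerarySet [Countable Γ] [l.NeBot]
    (hg : g.Surjective) (hΦ : ∀ i, IsEncoding S g pos (α i) (Φ i))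
    {Z : NonemptyCompacts (Γ → Cantor)}
    (hlim : Tendsto (fun i => (α i).itinerarySet (Φ i)) l (𝓝 Z)) :
    ∃ Y : CantorSubshift Γ, Y.carrier = Z := by
  have : CompactSpace Z := isCompact_iff_compactSpace.1 Z.isCompact
  have : Nonempty Z := Z.nonempty.to_subtype
  have : PerfectSpace Z := perfectSpace_of_tendsto_itinerarySet hg hΦ hlim
  have hshift (δ : Γ) : shift δ '' (Z : Set (Γ → Cantor)) = Z :=
    image_eq_of_tendsto hlim (continuous_shift δ) fun i => (α i).shift_image_itinerarySet (Φ i) δ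
  exact ⟨{
    carrier := Z
    isClosed := Z.isCompact.isClosed
    shift_mem := fun δ _ hy => hshift δ ▸ Set.mem_image_of_mem _ hy
    homeo := nonempty_homeomorph_cantor
    free := fun _ _ hy hfix =>
      by_contra fun hδ => shift_ne_of_tendsto_itinerarySet hΦ hlim hδ hy hfix }, rfl⟩

theorem eventually_mem_confFamily_iff
    (hΦ : ∀ i, IsEncoding S g pos (α i) (Φ i)) {Y : CantorSubshift Γ}
    {Z : NonemptyCompacts (Γ → Cantor)}
    (hlim : Tendsto (fun i => (α i).itinerarySet (Φ i)) l (𝓝 Z)) (hYZ : Y.carrier = Z) {n k : ℕ}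
    (A : Set (ball S n → (Fin k → Bool))) :
    ∀ᶠ i in l, A ∈ ConfFamily S (α i).map n k ↔ A ∈ ConfFamily S Y.map n k := by
  by_cases hA : A ∈ ConfFamily S Y.map n k
  · obtain ⟨φ, hφ, rfl⟩ := id hA
    obtain ⟨ψ, hψ⟩ := exists_continuous_extend_of_isClosed Y.isClosed ⟨φ, hφ⟩
    filter_upwards [eventually_conf_itinerary_eq hlim hYZ n ψ] with i hi
    refine iff_of_true ⟨_, ψ.continuous.comp ((α i).itinerary (Φ i)).continuous, ?_⟩ hA
    rw [hi]
    exact congrArg _ (funext hψ)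
  · let ψ : C(Γ → Cantor, Fin k → Bool) :=
      ⟨fun y j => y 1 (2 * pos (.inl ⟨n, k, A, j⟩)), by fun_prop⟩
    filter_upwards [eventually_conf_itinerary_eq hlim hYZ n ψ] with i hi
    refine iff_of_false (fun hAi => hA ⟨fun y => ψ y, by fun_prop, ?_⟩) hA
    rw [← hi, ← (hΦ i).realizes hAi]
    exact congrArg _ <| funext₂ fun x j => congrFun ((α i).itinerary_apply_one (Φ i) x) _

theorem exists_ultralimit [Countable Γ] (S : Finset Γ) (U : Ultrafilter ι)
    (α : ι → FreeCantorAction Γ) :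
    ∃ Y : CantorSubshift Γ, ∀ n k, ∀ᶠ i in U,
      ConfFamily S (α i).map n k = ConfFamily S Y.map n k := by
  obtain ⟨g, hg⟩ := exists_surjective_nat Γ
  obtain ⟨pos, hpos⟩ := exists_injective_nat (LabelIndex S)
  choose Φ hΦ using fun i => exists_isEncoding S g hpos (α i)
  let K i := (α i).itinerarySet (Φ i)
  obtain ⟨Z, -, hZ⟩ := isCompact_univ.ultrafilter_le_nhds (U.map K) (by simp)
  have hlim : Tendsto K U (𝓝 Z) := hZ
  obtain ⟨Y, hYZ⟩ := exists_cantorSubshift_of_tendsto_itinerarySet hg hΦ hlim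
  refine ⟨Y, fun n k => ?_⟩
  filter_upwards [eventually_all.2 (eventually_mem_confFamily_iff (n := n) (k := k) hΦ hlim hYZ)]
    with i hi
  exact Set.ext hi

end Ultralimit

section Conjugacy

variable {Γ : Type*} [Group Γ]

theorem CantorSubshift.exists_isConj (Y : CantorSubshift Γ) :
    ∃ β : FreeCantorAction Γ, Y.IsConj β := by
  obtain ⟨h⟩ := Y.homeo
  have hcont (δ : Γ) : Continuous (Y.map δ) :=
    ((continuous_shift δ).comp continuous_subtype_val).subtype_mk _
  let _ : MulAction Γ Y.carrier :=
    { smul := Y.map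
      one_smul := fun y => Subtype.ext (shift_one y.1)
      mul_smul := fun γ δ y => Subtype.ext (shift_mul γ δ y.1) }
  have : ContinuousConstSMul Γ Y.carrier := ⟨hcont⟩
  let transport (δ : Γ) : Cantor ≃ₜ Cantor := (h.symm.trans (Homeomorph.smul δ)).trans h
  have htransport (δ : Γ) (x : Cantor) : transport δ x = h (δ • h.symm x) := rfl
  refine ⟨{
    act := {
      toFun := transport
      map_one' := by
        ext1 x
        simp only [htransport, one_smul, h.apply_symm_apply, Homeomorph.one_apply]
      map_mul' := fun γ δ => by
        ext1 x
        simp only [htransport, mul_smul, h.symm_apply_apply, Homeomorph.mul_apply] }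
    free := fun γ x hx => Y.free γ _ (h.symm x).2 (congrArg Subtype.val (h.eq_symm_apply.2 hx)) },
    h, fun δ y => ?_⟩
  exact (congrArg (fun z => h (δ • z)) (h.symm_apply_apply y)).symm

variable {S : Finset Γ} {X X' : Type*} [TopologicalSpace X] [TopologicalSpace X']
  {a : Γ → X → X} {b : Γ → X' → X'}

theorem confFamily_subset_of_conj (h : X ≃ₜ X') (hab : ∀ γ x, h (a γ x) = b γ (h x))
    (n k : ℕ) : ConfFamily S b n k ⊆ ConfFamily S a n k := by
  rintro _ ⟨φ, hφ, rfl⟩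
  refine ⟨φ ∘ h, hφ.comp h.continuous, ?_⟩
  rw [Conf, Conf, ← h.surjective.range_comp]
  exact congrArg Set.range (funext₂ fun x γ => congrArg φ (hab γ x))

theorem CantorSubshift.IsConj.confFamily_eq {Y : CantorSubshift Γ} {β : FreeCantorAction Γ}
    (h : Y.IsConj β) (n k : ℕ) : ConfFamily S Y.map n k = ConfFamily S β.map n k := by
  obtain ⟨e, he⟩ := h
  refine (confFamily_subset_of_conj e.symm (fun γ x => ?_) n k).antisymm
    (confFamily_subset_of_conj e he n k)
  rw [e.symm_apply_eq, he, e.apply_symm_apply]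

end Conjugacy

section Metric

open FreeCantorAction

variable {Γ : Type*} [Group Γ] {S : Finset Γ}

theorem confFamily_subset_of_le {X X' : Type*} [TopologicalSpace X] [TopologicalSpace X']
    {a : Γ → X → X} {b : Γ → X' → X'} {n k N : ℕ} (hn : n ≤ N) (hk : k ≤ N)
    (h : ConfFamily S a N N ⊆ ConfFamily S b N N) : ConfFamily S a n k ⊆ ConfFamily S b n k := by
  rintro _ ⟨φ, hφ, rfl⟩
  let pad (v : Fin k → Bool) (i : Fin N) : Bool := if hi : i.1 < k then v ⟨i, hi⟩ else false
  let truncate (w : Fin N → Bool) (i : Fin k) : Bool := w (Fin.castLE hk i)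
  have truncate_pad : truncate ∘ pad ∘ φ = φ := by
    funext x i
    simp [truncate, pad]
  obtain ⟨φ', hφ', hconf⟩ := h ⟨pad ∘ φ, continuous_of_discreteTopology.comp hφ, rfl⟩
  refine ⟨truncate ∘ φ', continuous_of_discreteTopology.comp hφ', ?_⟩
  rw [conf_comp S b hn φ' truncate, hconf, ← conf_comp S a hn (pad ∘ φ) truncate, truncate_pad]

theorem confFamily_eq_of_le {X X' : Type*} [TopologicalSpace X] [TopologicalSpace X']
    {a : Γ → X → X} {b : Γ → X' → X'} {n k N : ℕ} (hn : n ≤ N) (hk : k ≤ N)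
    (h : ConfFamily S a N N = ConfFamily S b N N) : ConfFamily S a n k = ConfFamily S b n k :=
  (confFamily_subset_of_le hn hk h.le).antisymm (confFamily_subset_of_le hn hk h.ge)

theorem dist_cls_lt_iff {α β : FreeCantorAction Γ} {N : ℕ} (hN : 1 ≤ N) :
    dist (cls S α) (cls S β) < (1 / 2 : ℝ) ^ N ↔
      ConfFamily S α.map N N = ConfFamily S β.map N N := by
  change weakDist S α β < _ ↔ _
  refine ⟨fun h => by_contra fun hne => (le_weakDist ⟨hN, hne⟩).not_gt h, fun h => ?_⟩
  unfold weakDist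
  split_ifs with hne
  · refine pow_lt_pow_right_of_lt_one₀ (by norm_num) (by norm_num) (not_le.1 fun hle => ?_)
    exact (Nat.sInf_mem hne).2 (confFamily_eq_of_le hle hle h)
  · positivity

theorem tendsto_cls_iff {ι : Type*} {l : Filter ι} {α : ι → FreeCantorAction Γ}
    {β : FreeCantorAction Γ} :
    Tendsto (fun i => cls S (α i)) l (𝓝 (cls S β)) ↔
      ∀ n k, ∀ᶠ i in l, ConfFamily S (α i).map n k = ConfFamily S β.map n k := by
  refine ⟨fun h n k => ?_, fun h => Metric.tendsto_nhds.2 fun ε hε => ?_⟩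
  · have hclose := Metric.tendsto_nhds.1 h ((1 / 2) ^ (n + k + 1)) (by positivity)
    filter_upwards [hclose] with i hi
    exact confFamily_eq_of_le (by omega) (by omega) ((dist_cls_lt_iff (by omega)).1 hi)
  · obtain ⟨N, hN⟩ := exists_pow_lt_of_lt_one hε (show (1 / 2 : ℝ) < 1 by norm_num)
    filter_upwards [h (N + 1) (N + 1)] with i hi
    calc dist (cls S (α i)) (cls S β) < (1 / 2) ^ (N + 1) := (dist_cls_lt_iff (by omega)).2 hi
      _ ≤ (1 / 2) ^ N := pow_le_pow_of_le_one (by norm_num) (by norm_num) N.le_succ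
      _ < ε := hN

end Metric

section Compactness

open FreeCantorAction

variable {Γ : Type*} [Group Γ] {S : Finset Γ}

theorem countable_of_closure_eq_top {s : Set Γ} [Countable s] (hs : Subgroup.closure s = ⊤) :
    Countable Γ := by
  have hlift : Function.Surjective (FreeGroup.lift ((↑) : s → Γ)) := by
    rwa [FreeGroup.lift_surjective_iff_closure_range_eq_top, Subtype.range_coe]
  exact hlift.countable

theorem exists_isConj_tendsto_cls [Countable Γ] {ι : Type*} (U : Ultrafilter ι)
    (α : ι → FreeCantorAction Γ) : ∃ (Y : CantorSubshift Γ) (β : FreeCantorAction Γ),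
      Y.IsConj β ∧ Tendsto (fun i => cls S (α i)) U (𝓝 (cls S β)) := by
  obtain ⟨Y, hY⟩ := exists_ultralimit S U α
  obtain ⟨β, hβ⟩ := Y.exists_isConj
  refine ⟨Y, β, hβ, tendsto_cls_iff.2 fun n k => ?_⟩
  simpa only [hβ.confFamily_eq] using hY n k

instance compactSpace_free [Countable Γ] (S : Finset Γ) : CompactSpace (Free S) := by
  refine ⟨isCompact_iff_ultrafilter_le_nhds.2 fun U _ => ?_⟩
  obtain ⟨-, β, -, hβ⟩ := exists_isConj_tendsto_cls U (Quotient.out (s := weakSetoid S))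
  refine ⟨cls S β, Set.mem_univ _, ?_⟩
  have hout : (fun x : Free S => cls S (Quotient.out (s := weakSetoid S) x)) = id :=
    funext fun x => Quotient.out_eq (s := weakSetoid S) x
  rwa [hout, tendsto_id'] at hβ

theorem surviving_iff_of_tendsto_cls {α : ℕ → FreeCantorAction Γ} {β : FreeCantorAction Γ}
    (h : Tendsto (fun j => cls S (α j)) atTop (𝓝 (cls S β))) {n k : ℕ}
    {A : Set (ball S n → (Fin k → Bool))} :
    Surviving S α n k A ↔ A ∈ ConfFamily S β.map n k := by
  have hmem : ∀ᶠ j in atTop, A ∈ ConfFamily S (α j).map n k ↔ A ∈ ConfFamily S β.map n k :=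
    (tendsto_cls_iff.1 h n k).mono fun j hj => by rw [hj]
  exact (eventually_congr hmem).trans eventually_const

end Compactness

end QualWeak

open QualWeak in
theorem mainTheorem2_general {Γ : Type*} [Group Γ] [Countable Γ] (S : Finset Γ) :
    CompactSpace (Free S) ∧
    ∀ α : ℕ → FreeCantorAction Γ, CauchySeq (fun j => cls S (α j)) →
      ∃ (Y : CantorSubshift Γ) (β : FreeCantorAction Γ), Y.IsConj β ∧
        Tendsto (fun j => cls S (α j)) atTop (𝓝 (cls S β)) ∧
        ∀ (n k : ℕ) (A : Set (ball S n → (Fin k → Bool))),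
          A ∈ ConfFamily S Y.map n k ↔ Surviving S α n k A := by
  refine ⟨inferInstance, fun α hα => ?_⟩
  obtain ⟨Y, β, hYβ, hlim⟩ := exists_isConj_tendsto_cls (S := S) (hyperfilter ℕ) α
  have hβ : Tendsto (fun j => cls S (α j)) atTop (𝓝 (cls S β)) :=
    tendsto_nhds_of_cauchySeq_of_subseq hα Nat.hyperfilter_le_atTop hlim
  refine ⟨Y, β, hYβ, hβ, fun n k A => ?_⟩
  rw [hYβ.confFamily_eq, surviving_iff_of_tendsto_cls hβ]

open QualWeak in
theorem mainTheorem2 {Γ : Type*} [Group Γ] (S : Finset Γ)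
    (hsymm : ∀ s ∈ S, s⁻¹ ∈ S) (hgen : Subgroup.closure (S : Set Γ) = ⊤) :
    CompactSpace (Free S) ∧
    ∀ α : ℕ → FreeCantorAction Γ, CauchySeq (fun j => cls S (α j)) →
      ∃ (Y : CantorSubshift Γ) (β : FreeCantorAction Γ), Y.IsConj β ∧
        Tendsto (fun j => cls S (α j)) atTop (𝓝 (cls S β)) ∧
        ∀ n k : ℕ, 1 ≤ n → 1 ≤ k → ∀ A : Set (ball S n → (Fin k → Bool)),
          A ∈ ConfFamily S Y.map n k ↔ Surviving S α n k A := by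
  have : Countable Γ := countable_of_closure_eq_top hgen
  refine (mainTheorem2_general S).imp_right fun hlim α hα => ?_
  obtain ⟨Y, β, hYβ, hβ, hsurviving⟩ := hlim α hα
  exact ⟨Y, β, hYβ, hβ, fun n k _ _ => hsurviving n k⟩
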